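/- For $r\ge 0$ let $\Psi_{r,1}(t)=t/\log^r(t+e)$, $t\ge 0$, let $\Psi_{r,1}^{-1}(s)=\inf\{t\ge 0:\Psi_{r,1}(t)\ge s\}$, $s\geq 0$ (this is the inverse function of $\Psi_{r,1}$ whenever $\Psi_{r,1}$ is strictly increasing), and let $\rho_{\Psi_{r,1}}(t)=t^{-1}/\Psi_{r,1}^{-1}(t^{-1})$, $t>0$. Let $BMO(\rho_{\Psi_{r,1}})(\mathbb{T})$ be the set of all $u\in L^2(\mathbb{T})$ with \[ \sup_{I\subseteq\mathbb{T}\ \mathrm{arc}}\ \frac{1}{[\rho_{\Psi_{r,1}}(|I|)]^2|I|}\int_I\left|u(e^{2\pi i\theta})-\langle u\rangle_I\right|^2\,\mathrm{d}\theta<\infty, \] where $|I|$ is the length of $I$ normalised so that $|\mathbb{T}|=1$ and $\langle u\rangle_I$ is the average of $u$ over $I$. Let $BMOA(\rho_{\Psi_{r,1}})(\mathbb{T})$ be the set of those $u\in BMO(\rho_{\Psi_{r,1}})(\mathbb{T})$ that are boundary values of a holomorphic function $F$ on the unit disc (that is, $F(s e^{2\pi i\theta})\to u(e^{2\pi i\theta})$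 in $L^2(\mathbb{T})$ as $s\to1^-$), and let $LMOA(\mathbb{T})=BMOA(\rho_{\Psi_{1,1}})(\mathbb{T})$. (a) Let $r\ge0$ and let $\{a_j\}_{j=0}^\infty$ be a sequence of complex numbers. The lacunary trigonometric series $\sum_{j=0}^\infty a_je^{2\pi i2^j\theta}$ is the Fourier series of a function in $BMOA(\rho_{\Psi_{r,1}})(\mathbb{T})$ if and only if \[ \sup_{N\in\mathbb{N},\,N\ge1}\left\{\left(\frac{\Psi_{r,1}^{-1}(N)}{N}\right)^2\sum_{j\ge\log N}|a_j|^2\right\}<\infty . \] (b) For every sequence $\{a_j\}_{j=0}^\infty$ of complex numbers, $\sum_{j=0}^\infty a_je^{2\pi i2^j\theta}$ is the Fourier series of a function in $LMOA(\mathbb{T})$ if and only if \[ \sup_{N\in\mathbb{N},\,N\ge1}\left\{\log^2 N\sum_{j\ge\log N}|a_j|^2\right\}<\infty , \] with the convention $0\cdot\infty=0$. -/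

import Mathlib

open MeasureTheory Filter Topology
open scoped ENNReal

/-- The growth function `Ψ_{r,1}(t) = t / log^r (t + e)`, `t ≥ 0`. -/
noncomputable def growthPsi (r : ℝ) (t : ℝ) : ℝ :=
  t / (Real.log (t + Real.exp 1)) ^ r

/-- The (generalised) inverse `Ψ⁻¹(s) = inf {t ≥ 0 : Ψ(t) ≥ s}` of a function on `[0, ∞)`. -/
noncomputable def growthInv (Ψ : ℝ → ℝ) (s : ℝ) : ℝ :=
  sInf {t : ℝ | 0 ≤ t ∧ s ≤ Ψ t}

/-- Where `Ψ` is strictly increasing on `[0, ∞)`, `growthInv Ψ` is its inverse. -/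
theorem growthInv_apply {Ψ : ℝ → ℝ} (hΨ : StrictMonoOn Ψ (Set.Ici 0)) {t : ℝ} (ht : 0 ≤ t) :
    growthInv Ψ (Ψ t) = t :=
  IsLeast.csInf_eq ⟨⟨ht, le_rfl⟩, fun _ hx => (hΨ.le_iff_le ht hx.1).1 hx.2⟩

/-- `ρ_Ψ(t) = t⁻¹ / Ψ⁻¹(t⁻¹)`, `t > 0`. -/
noncomputable def growthRho (Ψ : ℝ → ℝ) (t : ℝ) : ℝ :=
  t⁻¹ / growthInv Ψ t⁻¹

/-- The average of `u` over the arc of `𝕋 = ℝ/ℤ` that starts at `c` and has length `ℓ`. -/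
noncomputable def arcAverage (u : UnitAddCircle → ℂ) (c ℓ : ℝ) : ℂ :=
  (ℓ : ℂ)⁻¹ * ∫ θ in c..(c + ℓ), u (θ : UnitAddCircle)

/-- `BMO(ρ)(𝕋)`: the functions `u ∈ L²(𝕋)` for which
`(ρ(|I|)² |I|)⁻¹ ∫_I |u - ⟨u⟩_I|²` is bounded over all arcs `I`. -/
def BMO (ρ : ℝ → ℝ) : Set (UnitAddCircle → ℂ) :=
  {u | MemLp u 2 (volume : Measure UnitAddCircle) ∧
    ∃ C : ℝ, ∀ c ℓ : ℝ, 0 < ℓ → ℓ ≤ 1 →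
      1 / ((ρ ℓ) ^ 2 * ℓ) *
        ∫ θ in c..(c + ℓ), ‖u (θ : UnitAddCircle) - arcAverage u c ℓ‖ ^ 2 ≤ C}

/-- `u` is the boundary function of `F : 𝔻 → ℂ`: the dilates `θ ↦ F(s e^{2πiθ})` tend to `u`
in `L²(𝕋)` as `s → 1⁻`. For `u ∈ L²(𝕋)` and `F` holomorphic this is the same as convergence in the
sense of distributions, and the same as `F` being in `H²(𝔻)` with radial limits `u` a.e. -/
def IsBoundaryValue (F : ℂ → ℂ) (u : UnitAddCircle → ℂ) : Prop :=
  Tendsto (fun s : ℝ =>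
      eLpNorm (fun θ : UnitAddCircle => F ((s : ℂ) * fourier 1 θ) - u θ) 2
        (volume : Measure UnitAddCircle))
    (𝓝[<] 1) (𝓝 0)

/-- `BMOA(ρ)(𝕋)`: the functions in `BMO(ρ)(𝕋)` that are boundary values of holomorphic functions
on the unit disc. -/
def BMOA (ρ : ℝ → ℝ) : Set (UnitAddCircle → ℂ) :=
  {u | u ∈ BMO ρ ∧
    ∃ F : ℂ → ℂ, DifferentiableOn ℂ F (Metric.ball 0 1) ∧ IsBoundaryValue F u}

/-- `LMOA(𝕋)`, the case `Ψ(t) = t / log (t + e)`. -/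
def LMOA : Set (UnitAddCircle → ℂ) :=
  BMOA (growthRho (growthPsi 1))

/-- The lacunary series `∑_j a_j e^{2πi 2^j θ}` is the Fourier series of `u`. -/
def IsLacunaryFourierSeries (a : ℕ → ℂ) (u : UnitAddCircle → ℂ) : Prop :=
  (∀ j : ℕ, fourierCoeff u (2 ^ j : ℤ) = a j) ∧
    ∀ n : ℤ, (∀ j : ℕ, n ≠ 2 ^ j) → fourierCoeff u n = 0

/-- The tail `∑_{j ≥ log N} |a_j|² ∈ [0, ∞]`. -/
noncomputable def logTail (a : ℕ → ℂ) (N : ℕ) : ℝ≥0∞ :=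
  ∑' j : {j : ℕ // Real.log N ≤ j}, ‖a j‖ₑ ^ 2

open scoped ComplexConjugate

/-! Both halves pass through one condition, `TailDecay`: the tails of `∑ |a_j|²` from index `M` on
are `O((1 + M)^(-2r))`. For `s ≥ 1` the quotient `Ψ⁻¹(s) / s` is comparable to `(1 + log s)^r`, so
`1 / ρ(ℓ)` is comparable to `(1 + log (1/ℓ))^r`, and the suprema in the statement are rewritings of
`TailDecay`. What remains is to compare it with the oscillation of `u` on arcs.

On an arc of length `2⁻ᴹ` the exponentials of frequency `2^j`, `j ≥ M`, have mean zero and are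
mutually orthogonal, since their frequencies are multiples of `2^M`. For necessity, test `u` against
the block `M ≤ j < J` on each of the `2^M` arcs that tile the circle: constants drop out, and
summing bounds the block's `ℓ²` mass by the oscillation of `u` (`sum_normSq_le_of_arcs`).

For sufficiency, take an arc of length about `2⁻ᴹ`. The frequencies below `2^M` form a Lipschitz
function whose variation is `O((1 + M)^(-r))` (`TailDecay.exists_low_frequency_bound`); the others
contribute exactly their `ℓ²` mass on an arc of length `2⁻ᴹ`. The holomorphic extension is `∑ a_j
z^(2^j)`. -/

/-! ### Size of `Ψ⁻¹(s) / s` -/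

theorem one_le_log_add_exp {t : ℝ} (ht : 0 ≤ t) : 1 ≤ Real.log (t + Real.exp 1) := by
  rw [Real.le_log_iff_exp_le (by positivity)]
  linarith

theorem le_growthPsi_iff {r s t : ℝ} (ht : 0 ≤ t) :
    s ≤ growthPsi r t ↔ s * Real.log (t + Real.exp 1) ^ r ≤ t := by
  have h := one_le_log_add_exp ht
  rw [growthPsi, le_div_iff₀ (by positivity)]

theorem log_rpow_le_sqrt {r t : ℝ} (hr : 0 ≤ r) (ht : 1 ≤ t) :
    Real.log (t + Real.exp 1) ^ r ≤ 2 * (2 * (r + 1)) ^ r * √t := by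
  have he : Real.exp 1 < 3 := lt_trans Real.exp_one_lt_d9 (by norm_num)
  have hl := one_le_log_add_exp (zero_le_one.trans ht)
  have hpos : 0 < t + Real.exp 1 := by positivity
  have h1 : Real.log (t + Real.exp 1) ≤
      (2 * (r + 1)) * (t + Real.exp 1) ^ (1 / (2 * (r + 1))) := by
    have := Real.log_le_rpow_div hpos.le (ε := 1 / (2 * (r + 1))) (by positivity)
    refine this.trans (le_of_eq ?_)
    field_simp
  have h2 : ((t + Real.exp 1) ^ (1 / (2 * (r + 1)))) ^ r ≤ 2 * √t := by
    rw [← Real.rpow_mul hpos.le]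
    calc (t + Real.exp 1) ^ (1 / (2 * (r + 1)) * r) ≤ (t + Real.exp 1) ^ (1 / 2 : ℝ) := by
          apply Real.rpow_le_rpow_of_exponent_le
          · linarith [Real.exp_pos 1]
          -- The exponent is `r / (2(r + 1)) ≤ 1/2`; using `r + 1` in place of `r` keeps it
          -- meaningful at `r = 0`.
          · rw [div_mul_eq_mul_div, div_le_div_iff₀ (by positivity) (by positivity)]
            linarith
      _ = √(t + Real.exp 1) := (Real.sqrt_eq_rpow _).symm
      _ ≤ √(2 ^ 2 * t) := Real.sqrt_le_sqrt (by linarith)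
      _ = 2 * √t := by
          rw [Real.sqrt_mul (by positivity), Real.sqrt_sq (by positivity)]
  calc Real.log (t + Real.exp 1) ^ r
      ≤ ((2 * (r + 1)) * (t + Real.exp 1) ^ (1 / (2 * (r + 1)))) ^ r :=
        Real.rpow_le_rpow (by linarith) h1 hr
    _ = (2 * (r + 1)) ^ r * ((t + Real.exp 1) ^ (1 / (2 * (r + 1)))) ^ r :=
        Real.mul_rpow (by positivity) (by positivity)
    _ ≤ (2 * (r + 1)) ^ r * (2 * √t) := by gcongr
    _ = 2 * (2 * (r + 1)) ^ r * √t := by ring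

/-- A bootstrap. If the proposed `t` failed, the crude bound `log^r (t + e) ≤ B √t` would give `t <
s² B²`; then `log (t + e) = O(1 + log s)`, which is strong enough to show that `t` does not fail. No
monotonicity of `Ψ` is used; it can fail for large `r`. -/
theorem exists_le_growthPsi (r : ℝ) (hr : 0 ≤ r) :
    ∃ D : ℝ, 0 < D ∧ ∀ s : ℝ, 1 ≤ s →
      s ≤ growthPsi r (s * (D * (1 + Real.log s) ^ r)) := by
  set B : ℝ := 2 * (2 * (r + 1)) ^ r with hB
  have hBpos : 0 < B := by positivity
  set E : ℝ := 2 + Real.log (B ^ 2 + Real.exp 1) with hE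
  have hE1 : 1 ≤ E := by
    have := one_le_log_add_exp (sq_nonneg B)
    linarith
  refine ⟨E ^ r, by positivity, fun s hs => ?_⟩
  have hls : 0 ≤ Real.log s := Real.log_nonneg hs
  set t : ℝ := s * (E ^ r * (1 + Real.log s) ^ r) with ht
  have ht1 : 1 ≤ t := by
    have h1 : 1 ≤ E ^ r := Real.one_le_rpow hE1 hr
    have h2 : 1 ≤ (1 + Real.log s) ^ r := Real.one_le_rpow (by linarith) hr
    exact one_le_mul_of_one_le_of_one_le hs (one_le_mul_of_one_le_of_one_le h1 h2)
  rw [le_growthPsi_iff (by linarith)]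
  by_contra! hlt
  have h3 : t < s * (B * √t) :=
    hlt.trans_le (mul_le_mul_of_nonneg_left (log_rpow_le_sqrt hr ht1) (by linarith))
  have h4 : √t < s * B := by
    have hst : 0 < √t := Real.sqrt_pos.2 (by linarith)
    have : √t * √t < s * B * √t := by
      rw [Real.mul_self_sqrt (by linarith)]; linarith
    exact lt_of_mul_lt_mul_right this hst.le
  have h5 : t < s ^ 2 * B ^ 2 := by
    have := (Real.sqrt_lt' (by positivity)).1 h4
    linarith [mul_pow s B 2]
  have h6 : Real.log (t + Real.exp 1) ≤ E * (1 + Real.log s) := by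
    have h7 : t + Real.exp 1 ≤ s ^ 2 * (B ^ 2 + Real.exp 1) := by
      have : 1 ≤ s ^ 2 := one_le_pow₀ hs
      nlinarith [Real.exp_pos 1]
    have h8 := Real.log_le_log (by positivity) h7
    rw [Real.log_mul (by positivity) (by positivity), Real.log_pow] at h8
    push_cast at h8
    have := one_le_log_add_exp (sq_nonneg B)
    nlinarith
  have h9 : Real.log (t + Real.exp 1) ^ r ≤ E ^ r * (1 + Real.log s) ^ r := by
    rw [← Real.mul_rpow (by linarith) (by linarith)]
    exact Real.rpow_le_rpow (by linarith [one_le_log_add_exp (zero_le_one.trans ht1)]) h6 hr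
  have := mul_le_mul_of_nonneg_left h9 (zero_le_one.trans hs)
  linarith

theorem growthInv_le (r : ℝ) (hr : 0 ≤ r) :
    ∃ D : ℝ, 0 < D ∧ ∀ s : ℝ, 1 ≤ s →
      growthInv (growthPsi r) s / s ≤ D * (1 + Real.log s) ^ r := by
  obtain ⟨D, hD, h⟩ := exists_le_growthPsi r hr
  refine ⟨D, hD, fun s hs => ?_⟩
  have hls : 0 ≤ Real.log s := Real.log_nonneg hs
  rw [div_le_iff₀ (by linarith), mul_comm]
  exact csInf_le ⟨0, fun _ hx => hx.1⟩ ⟨by positivity, h s hs⟩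

theorem log_rpow_le_growthInv {r s : ℝ} (hr : 0 ≤ r) (hs : 1 ≤ s) :
    Real.log (s + Real.exp 1) ^ r ≤ growthInv (growthPsi r) s / s := by
  obtain ⟨D, hD, h⟩ := exists_le_growthPsi r hr
  have hls : 0 ≤ Real.log s := Real.log_nonneg hs
  rw [le_div_iff₀ (by linarith), mul_comm]
  -- Nonemptiness matters: over an empty set `sInf` would be the default value `0`.
  refine le_csInf ⟨_, by positivity, h s hs⟩ fun t ht => ?_
  have h0 : 0 ≤ s := by linarith
  have h1 := (le_growthPsi_iff ht.1).1 ht.2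
  have h2 : s ≤ t := by
    refine le_trans ?_ h1
    exact le_mul_of_one_le_right h0 (Real.one_le_rpow (one_le_log_add_exp ht.1) hr)
  refine le_trans ?_ h1
  have h3 := one_le_log_add_exp h0
  gcongr

theorem one_le_growthInv_div {r s : ℝ} (hr : 0 ≤ r) (hs : 1 ≤ s) :
    1 ≤ growthInv (growthPsi r) s / s :=
  (Real.one_le_rpow (one_le_log_add_exp (by linarith)) hr).trans (log_rpow_le_growthInv hr hs)

/-! ### The suprema over `N` and decay of the tails -/

/-- Polynomial decay of order `2r` of the tails of `∑ |a_j|²`. -/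
def TailDecay (r : ℝ) (a : ℕ → ℂ) : Prop :=
  ∃ K : ℝ, ∀ M J : ℕ, (((1 : ℝ) + M) ^ r) ^ 2 * ∑ j ∈ Finset.Ico M J, ‖a j‖ ^ 2 ≤ K

/-- Replaces a possibly infinite tail by uniform bounds on its finite partial sums. The convention
`0 · ∞ = 0` agrees with this: for `w = 0` both sides hold. -/
theorem ofReal_mul_logTail_le_iff {w K : ℝ} (hw : 0 ≤ w) (hK : 0 ≤ K) (a : ℕ → ℂ) (N : ℕ) :
    ENNReal.ofReal w * logTail a N ≤ ENNReal.ofReal K ↔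
      ∀ J : ℕ, w * ∑ j ∈ Finset.Ico ⌈Real.log N⌉₊ J, ‖a j‖ ^ 2 ≤ K := by
  have h1 : logTail a N = ⨆ J : ℕ, ENNReal.ofReal (∑ j ∈ Finset.Ico ⌈Real.log N⌉₊ J, ‖a j‖ ^ 2) := by
    have h2 : logTail a N =
        ∑' j, ({j : ℕ | Real.log N ≤ j}).indicator (fun j => ‖a j‖ₑ ^ 2) j :=
      tsum_subtype {j : ℕ | Real.log N ≤ j} (fun j => ‖a j‖ₑ ^ 2)
    rw [h2, ENNReal.tsum_eq_iSup_nat]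
    refine iSup_congr fun J => ?_
    rw [ENNReal.ofReal_sum_of_nonneg (fun _ _ => by positivity),
      Finset.sum_indicator_eq_sum_filter]
    refine Finset.sum_congr ?_ fun j _ => ?_
    · ext j
      simp [Nat.ceil_le, and_comm]
    · rw [ENNReal.ofReal_pow (norm_nonneg _), ofReal_norm]
  rw [h1, ENNReal.mul_iSup, iSup_le_iff]
  refine forall_congr' fun J => ?_
  rw [← ENNReal.ofReal_mul hw, ENNReal.ofReal_le_ofReal_iff hK]

theorem iSup_mul_logTail_lt_top_iff {w : ℕ → ℝ} (hw : ∀ N, 0 ≤ w N) (a : ℕ → ℂ) :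
    (⨆ (N : ℕ) (_ : 1 ≤ N), ENNReal.ofReal (w N) * logTail a N) < ⊤ ↔
      ∃ K : ℝ, ∀ N : ℕ, 1 ≤ N → ∀ J : ℕ,
        w N * ∑ j ∈ Finset.Ico ⌈Real.log N⌉₊ J, ‖a j‖ ^ 2 ≤ K := by
  constructor
  · intro h
    refine ⟨(⨆ (N : ℕ) (_ : 1 ≤ N), ENNReal.ofReal (w N) * logTail a N).toReal, fun N hN =>
      (ofReal_mul_logTail_le_iff (hw N) ENNReal.toReal_nonneg a N).1 ?_⟩
    rw [ENNReal.ofReal_toReal h.ne]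
    exact le_iSup₂ (f := fun (N : ℕ) (_ : 1 ≤ N) => ENNReal.ofReal (w N) * logTail a N) N hN
  · rintro ⟨K, hK⟩
    have hK0 : 0 ≤ K := by simpa using hK 1 le_rfl 0
    refine lt_of_le_of_lt (iSup₂_le fun N hN => ?_) (ENNReal.ofReal_lt_top (r := K))
    exact (ofReal_mul_logTail_le_iff (hw N) hK0 a N).2 (hK N hN)

theorem rpow_one_add_le {r : ℝ} (hr : 0 ≤ r) {x y : ℝ} (hx : 0 ≤ x) (hy : 1 ≤ y) (C : ℝ)
    (hC : 1 ≤ C) (hxy : x ≤ C * y) : (1 + x) ^ r ≤ (2 * C) ^ r * y ^ r := by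
  rw [← Real.mul_rpow (by linarith) (by linarith)]
  exact Real.rpow_le_rpow (by linarith) (by nlinarith) hr

theorem tailDecay_iff_growthInv {r : ℝ} (hr : 0 ≤ r) (a : ℕ → ℂ) :
    (⨆ (N : ℕ) (_ : 1 ≤ N),
      ENNReal.ofReal ((growthInv (growthPsi r) N / N) ^ 2) * logTail a N) < ⊤ ↔
      TailDecay r a := by
  rw [iSup_mul_logTail_lt_top_iff (fun N => sq_nonneg _)]
  constructor
  · rintro ⟨K, hK⟩
    refine ⟨((2 * 1 : ℝ) ^ r) ^ 2 * K, fun M J => ?_⟩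
    -- This `N` has `log N ≤ M`, so its tail contains the one from `M`, while `e^M < N + 1 < N + e`.
    set N : ℕ := ⌊Real.exp M⌋₊ with hN
    have hN1 : 1 ≤ N := Nat.le_floor (by simp)
    have hN1' : (1 : ℝ) ≤ N := by exact_mod_cast hN1
    have hle : Real.log N ≤ M := by
      rw [Real.log_le_iff_le_exp (by linarith)]
      exact Nat.floor_le (Real.exp_pos _).le
    have hge : (M : ℝ) ≤ Real.log (N + Real.exp 1) := by
      rw [Real.le_log_iff_exp_le (by positivity)]
      have := Nat.lt_floor_add_one (Real.exp M)
      have := Real.add_one_le_exp 1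
      linarith
    have h1 : ((1 : ℝ) + M) ^ r ≤ (2 * 1 : ℝ) ^ r * (growthInv (growthPsi r) N / N) :=
      (rpow_one_add_le hr (Nat.cast_nonneg M) (one_le_log_add_exp (t := N) (by linarith)) 1 le_rfl
        (by linarith)).trans (by gcongr; exact log_rpow_le_growthInv hr hN1')
    have h2 : ∑ j ∈ Finset.Ico M J, ‖a j‖ ^ 2 ≤
        ∑ j ∈ Finset.Ico ⌈Real.log N⌉₊ J, ‖a j‖ ^ 2 :=
      Finset.sum_le_sum_of_subset_of_nonneg
        (Finset.Ico_subset_Ico_left (Nat.ceil_le.2 hle)) fun _ _ _ => by positivity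
    calc (((1 : ℝ) + M) ^ r) ^ 2 * ∑ j ∈ Finset.Ico M J, ‖a j‖ ^ 2
        ≤ ((2 * 1 : ℝ) ^ r * (growthInv (growthPsi r) N / N)) ^ 2 *
          ∑ j ∈ Finset.Ico ⌈Real.log N⌉₊ J, ‖a j‖ ^ 2 := by gcongr
      _ = ((2 * 1 : ℝ) ^ r) ^ 2 * ((growthInv (growthPsi r) N / N) ^ 2 *
          ∑ j ∈ Finset.Ico ⌈Real.log N⌉₊ J, ‖a j‖ ^ 2) := by ring
      _ ≤ _ := by gcongr; exact hK N hN1 J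
  · rintro ⟨K, hK⟩
    obtain ⟨D, hD, h⟩ := growthInv_le r hr
    refine ⟨D ^ 2 * K, fun N hN J => ?_⟩
    have hN1 : (1 : ℝ) ≤ N := by exact_mod_cast hN
    have hl := Real.log_nonneg hN1
    have h0 := one_le_growthInv_div hr hN1
    have h1 : growthInv (growthPsi r) N / N ≤ D * (1 + (⌈Real.log N⌉₊ : ℝ)) ^ r :=
      (h N hN1).trans (by gcongr; exact Nat.le_ceil _)
    calc (growthInv (growthPsi r) N / N) ^ 2 * ∑ j ∈ Finset.Ico ⌈Real.log N⌉₊ J, ‖a j‖ ^ 2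
        ≤ (D * (1 + (⌈Real.log N⌉₊ : ℝ)) ^ r) ^ 2 *
          ∑ j ∈ Finset.Ico ⌈Real.log N⌉₊ J, ‖a j‖ ^ 2 := by gcongr
      _ = D ^ 2 * (((1 + (⌈Real.log N⌉₊ : ℝ)) ^ r) ^ 2 *
          ∑ j ∈ Finset.Ico ⌈Real.log N⌉₊ J, ‖a j‖ ^ 2) := by ring
      _ ≤ _ := by gcongr; exact hK _ J

theorem tailDecay_one_iff_log (a : ℕ → ℂ) :
    (⨆ (N : ℕ) (_ : 1 ≤ N), ENNReal.ofReal (Real.log N ^ 2) * logTail a N) < ⊤ ↔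
      TailDecay 1 a := by
  rw [iSup_mul_logTail_lt_top_iff (fun N => sq_nonneg _)]
  constructor
  · rintro ⟨K, hK⟩
    have hK0 : 0 ≤ K := by simpa using hK 1 le_rfl 0
    -- `M = 0` is excluded because the weight `log² N` vanishes at `N = 1`; that tail differs from
    -- the one from `1` by the single term `‖a 0‖²`.
    have hpos : ∀ M J : ℕ, 1 ≤ M →
        ((1 : ℝ) + M) ^ 2 * ∑ j ∈ Finset.Ico M J, ‖a j‖ ^ 2 ≤ 64 * K := by
      intro M J hM
      have hM' : (1 : ℝ) ≤ M := by exact_mod_cast hM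
      set N : ℕ := ⌊Real.exp M⌋₊ with hN
      have hN1 : 1 ≤ N := Nat.le_floor (by simp)
      have hN1' : (1 : ℝ) ≤ N := by exact_mod_cast hN1
      have hle : Real.log N ≤ M := by
        rw [Real.log_le_iff_le_exp (by linarith)]
        exact Nat.floor_le (Real.exp_pos _).le
      have hge : (M : ℝ) ≤ Real.log 2 + Real.log N := by
        rw [← Real.log_mul (by norm_num) (by linarith), Real.le_log_iff_exp_le (by positivity)]
        have := Nat.lt_floor_add_one (Real.exp M)
        linarith
      have hlog : (1 : ℝ) + M ≤ 8 * Real.log N := by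
        have := Real.log_two_lt_d9
        linarith
      have h2 : ∑ j ∈ Finset.Ico M J, ‖a j‖ ^ 2 ≤
          ∑ j ∈ Finset.Ico ⌈Real.log N⌉₊ J, ‖a j‖ ^ 2 :=
        Finset.sum_le_sum_of_subset_of_nonneg
          (Finset.Ico_subset_Ico_left (Nat.ceil_le.2 hle)) fun _ _ _ => by positivity
      calc ((1 : ℝ) + M) ^ 2 * ∑ j ∈ Finset.Ico M J, ‖a j‖ ^ 2
          ≤ (8 * Real.log N) ^ 2 * ∑ j ∈ Finset.Ico ⌈Real.log N⌉₊ J, ‖a j‖ ^ 2 := by gcongr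
        _ = 64 * (Real.log N ^ 2 * ∑ j ∈ Finset.Ico ⌈Real.log N⌉₊ J, ‖a j‖ ^ 2) := by ring
        _ ≤ _ := by gcongr; exact hK N hN1 J
    refine ⟨64 * K + ‖a 0‖ ^ 2, fun M J => ?_⟩
    rw [Real.rpow_one]
    rcases Nat.eq_zero_or_pos M with rfl | hM
    · rcases Nat.eq_zero_or_pos J with rfl | hJ
      · simp only [Finset.Ico_self, Finset.sum_empty, mul_zero]
        positivity
      · rw [Finset.sum_eq_sum_Ico_succ_bot hJ]
        have h1 := hpos 1 J le_rfl
        have h2 : 0 ≤ ∑ j ∈ Finset.Ico 1 J, ‖a j‖ ^ 2 :=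
          Finset.sum_nonneg fun _ _ => by positivity
        norm_num at h1 ⊢
        linarith
    · have := hpos M J hM
      nlinarith [sq_nonneg ‖a 0‖]
  · rintro ⟨K, hK⟩
    refine ⟨K, fun N hN J => le_trans ?_ (hK ⌈Real.log N⌉₊ J)⟩
    have hl : 0 ≤ Real.log N := Real.log_natCast_nonneg N
    rw [Real.rpow_one]
    gcongr
    linarith [Nat.le_ceil (Real.log N)]

/-! ### Lacunary blocks on arcs of length `2⁻ᴹ` -/

theorem fourier_add_two_pow_inv {m : ℤ} {M : ℕ} (hm : (2 ^ M : ℤ) ∣ m) (c : ℝ) :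
    fourier m ((c + (2 ^ M)⁻¹ : ℝ) : UnitAddCircle) = fourier m (c : UnitAddCircle) := by
  obtain ⟨k, rfl⟩ := hm
  rw [fourier_coe_apply, fourier_coe_apply, Complex.exp_eq_exp_iff_exists_int]
  refine ⟨k, ?_⟩
  push_cast
  field_simp

theorem integral_fourier_arc {m : ℤ} {M : ℕ} (hm0 : m ≠ 0) (hm : (2 ^ M : ℤ) ∣ m) (c : ℝ) :
    ∫ x in c..(c + (2 ^ M)⁻¹), fourier m (x : UnitAddCircle) = 0 := by
  have h := intervalIntegral.integral_eq_sub_of_hasDerivAt (a := c) (b := c + (2 ^ M)⁻¹)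
    (fun x _ => hasDerivAt_fourier 1 m x)
    (Continuous.intervalIntegrable (by fun_prop) _ _)
  rw [fourier_add_two_pow_inv hm, sub_self, intervalIntegral.integral_const_mul] at h
  refine (mul_eq_zero.1 h).resolve_left ?_
  simp [hm0, Real.pi_ne_zero]

/-- The lacunary trigonometric polynomial `∑_{j ∈ s} a_j e^{2πi 2^j x}`. -/
noncomputable def lacunaryPoly (a : ℕ → ℂ) (s : Finset ℕ) (x : ℝ) : ℂ :=
  ∑ j ∈ s, a j * fourier (2 ^ j) (x : UnitAddCircle)

theorem continuous_fourier_coe (m : ℤ) :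
    Continuous fun x : ℝ => (fourier m (x : UnitAddCircle) : ℂ) :=
  (fourier m).continuous.comp (AddCircle.continuous_mk' 1)

theorem continuous_const_mul_fourier_coe (z : ℂ) (m : ℤ) :
    Continuous fun x : ℝ => z * fourier m (x : UnitAddCircle) :=
  continuous_const.mul (continuous_fourier_coe m)

theorem continuous_lacunaryPoly (a : ℕ → ℂ) (s : Finset ℕ) : Continuous (lacunaryPoly a s) :=
  continuous_finsetSum _ fun _ _ => continuous_const_mul_fourier_coe _ _

theorem integral_lacunaryPoly {a : ℕ → ℂ} {s : Finset ℕ} {M : ℕ} (hs : ∀ j ∈ s, M ≤ j) (c : ℝ) :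
    ∫ x in c..(c + (2 ^ M)⁻¹), lacunaryPoly a s x = 0 := by
  unfold lacunaryPoly
  rw [intervalIntegral.integral_finsetSum fun j _ =>
    (continuous_const_mul_fourier_coe _ _).intervalIntegrable _ _]
  refine Finset.sum_eq_zero fun j hj => ?_
  rw [intervalIntegral.integral_const_mul,
    integral_fourier_arc (by positivity) (pow_dvd_pow 2 (hs j hj)), mul_zero]

/-- For `i ≠ j` in the block, `2^i - 2^j` is a nonzero multiple of `2^M`, so the cross terms
integrate to zero over the short arc. -/
theorem integral_normSq_lacunaryPoly {a : ℕ → ℂ} {s : Finset ℕ} {M : ℕ} (hs : ∀ j ∈ s, M ≤ j)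
    (c : ℝ) :
    ∫ x in c..(c + (2 ^ M)⁻¹), ‖lacunaryPoly a s x‖ ^ 2 = (2 ^ M)⁻¹ * ∑ j ∈ s, ‖a j‖ ^ 2 := by
  have h1 : ∀ x : ℝ, ((‖lacunaryPoly a s x‖ ^ 2 : ℝ) : ℂ) =
      ∑ i ∈ s, ∑ j ∈ s, (a i * conj (a j)) * fourier (2 ^ i - 2 ^ j) (x : UnitAddCircle) := by
    intro x
    rw [Complex.ofReal_pow, ← Complex.mul_conj', lacunaryPoly, map_sum, Finset.sum_mul_sum]
    refine Finset.sum_congr rfl fun i _ => Finset.sum_congr rfl fun j _ => ?_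
    rw [map_mul, ← fourier_neg, sub_eq_add_neg, fourier_add]
    ring
  have h2 : ((∫ x in c..(c + (2 ^ M)⁻¹), ‖lacunaryPoly a s x‖ ^ 2 : ℝ) : ℂ) =
      (2 ^ M)⁻¹ * ∑ j ∈ s, (‖a j‖ : ℂ) ^ 2 := by
    rw [← intervalIntegral.integral_ofReal]
    simp_rw [h1]
    rw [intervalIntegral.integral_finsetSum fun i _ => Continuous.intervalIntegrable
      (continuous_finsetSum _ fun j _ => continuous_const_mul_fourier_coe _ _) _ _,
      Finset.mul_sum]
    refine Finset.sum_congr rfl fun i hi => ?_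
    rw [intervalIntegral.integral_finsetSum fun j _ => Continuous.intervalIntegrable
      (continuous_const_mul_fourier_coe _ _) _ _]
    rw [Finset.sum_eq_single i]
    · rw [intervalIntegral.integral_const_mul, Complex.mul_conj', sub_self]
      simp [mul_comm]
    · intro j hj hji
      rw [intervalIntegral.integral_const_mul, integral_fourier_arc, mul_zero]
      · rw [sub_ne_zero]
        exact fun h => hji (Int.pow_right_injective (a := 2) (by norm_num) h).symm
      · exact dvd_sub (pow_dvd_pow 2 (hs i hi)) (pow_dvd_pow 2 (hs j hj))
    · exact fun h => absurd hi h
  apply Complex.ofReal_injective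
  rw [h2]
  push_cast
  rfl

/-! ### Necessity: testing the oscillation against a block -/

theorem volume_eq_haarAddCircle :
    (volume : Measure UnitAddCircle) = AddCircle.haarAddCircle := by
  have := AddCircle.volume_eq_smul_haarAddCircle (T := 1)
  rwa [ENNReal.ofReal_one, one_smul] at this

theorem memLp_comp_coe {u : UnitAddCircle → ℂ} (hu : MemLp u 2 (volume : Measure UnitAddCircle))
    (c : ℝ) {ℓ : ℝ} (hℓ : ℓ ≤ 1) :
    MemLp (fun x : ℝ => u (x : UnitAddCircle)) 2 (volume.restrict (Set.Ioc c (c + ℓ))) := by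
  have h := hu.comp_measurePreserving (UnitAddCircle.measurePreserving_mk c)
  exact h.mono_measure (Measure.restrict_mono (Set.Ioc_subset_Ioc_right (by linarith)) le_rfl)

theorem MeasureTheory.MemLp.intervalIntegrable_of_Ioc {v : ℝ → ℂ} {a b : ℝ} (hab : a ≤ b)
    (hv : MemLp v 2 (volume.restrict (Set.Ioc a b))) : IntervalIntegrable v volume a b := by
  rw [intervalIntegrable_iff_integrableOn_Ioc_of_le hab]
  exact hv.integrable (by norm_num)

theorem MeasureTheory.MemLp.intervalIntegrable_normSq {v : ℝ → ℂ} {a b : ℝ} (hab : a ≤ b)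
    (hv : MemLp v 2 (volume.restrict (Set.Ioc a b))) :
    IntervalIntegrable (fun x => ‖v x‖ ^ 2) volume a b := by
  rw [intervalIntegrable_iff_integrableOn_Ioc_of_le hab]
  exact (memLp_two_iff_integrable_sq_norm hv.aestronglyMeasurable).1 hv

/-- Testing the oscillation of `v` against a function of mean zero. -/
theorem re_integral_mul_conj_le_oscillation {v f : ℝ → ℂ} {a b : ℝ} (hab : a ≤ b)
    (hv : MemLp v 2 (volume.restrict (Set.Ioc a b))) (hf : Continuous f)
    (hf0 : ∫ x in a..b, f x = 0) (κ : ℂ) :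
    2 * (∫ x in a..b, v x * conj (f x)).re - ∫ x in a..b, ‖f x‖ ^ 2 ≤
      ∫ x in a..b, ‖v x - κ‖ ^ 2 := by
  have hc : Continuous fun x => conj (f x) := Complex.continuous_conj.comp hf
  have h1 : IntervalIntegrable (fun x => v x * conj (f x)) volume a b :=
    (hv.intervalIntegrable_of_Ioc hab).mul_continuousOn hc.continuousOn
  have h2 : IntervalIntegrable (fun x => κ * conj (f x)) volume a b :=
    (continuous_const.mul hc).intervalIntegrable _ _
  have h3 : IntervalIntegrable (fun x => ‖f x‖ ^ 2) volume a b :=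
    (hf.norm.pow 2).intervalIntegrable _ _
  have h4 : IntervalIntegrable (fun x => ‖v x - κ‖ ^ 2) volume a b :=
    (hv.sub (memLp_const κ)).intervalIntegrable_normSq hab
  have h5 : ∫ x in a..b, κ * conj (f x) = 0 := by
    rw [intervalIntegral.integral_const_mul]
    have : ∫ x in a..b, conj (f x) = conj (∫ x in a..b, f x) := by
      rw [intervalIntegral.integral_of_le hab, intervalIntegral.integral_of_le hab, integral_conj]
    rw [this, hf0, map_zero, mul_zero]
  have h6 : (∫ x in a..b, v x * conj (f x)).re =
      ∫ x in a..b, ((v x - κ) * conj (f x)).re := by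
    have h7 : ∫ x in a..b, (v x - κ) * conj (f x) = ∫ x in a..b, v x * conj (f x) := by
      simp_rw [sub_mul]
      rw [intervalIntegral.integral_sub h1 h2, h5, sub_zero]
    rw [← h7, intervalIntegral.integral_of_le hab, intervalIntegral.integral_of_le hab]
    refine (integral_re (𝕜 := ℂ) ?_).symm
    rw [← IntegrableOn, ← intervalIntegrable_iff_integrableOn_Ioc_of_le hab]
    simpa only [sub_mul] using h1.sub h2
  have h8 : IntervalIntegrable (fun x => ((v x - κ) * conj (f x)).re) volume a b := by
    have := h1.sub h2
    simp_rw [← sub_mul] at this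
    rw [intervalIntegrable_iff_integrableOn_Ioc_of_le hab] at this ⊢
    exact this.re
  rw [h6, ← intervalIntegral.integral_const_mul, ← intervalIntegral.integral_sub
    (h8.const_mul 2) h3]
  refine intervalIntegral.integral_mono_on hab ((h8.const_mul 2).sub h3) h4 fun x _ => ?_
  -- Expanding this square gives `2 Re (w f̄) - |f|² ≤ |w|²` with `w = v - κ`.
  have h9 := sq_nonneg ‖(v x - κ) - f x‖
  rw [Complex.sq_norm, Complex.normSq_sub] at h9
  rw [Complex.sq_norm, Complex.sq_norm]
  linarith

theorem integral_mul_conj_lacunaryPoly {a : ℕ → ℂ} {u : UnitAddCircle → ℂ}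
    (hu : MemLp u 2 (volume : Measure UnitAddCircle)) (ha : IsLacunaryFourierSeries a u)
    (s : Finset ℕ) :
    ∫ x in (0 : ℝ)..1, u (x : UnitAddCircle) * conj (lacunaryPoly a s x) =
      ((∑ j ∈ s, ‖a j‖ ^ 2 : ℝ) : ℂ) := by
  have hi : IntervalIntegrable (fun x : ℝ => u (x : UnitAddCircle)) volume 0 1 := by
    have := (memLp_comp_coe hu 0 le_rfl).intervalIntegrable_of_Ioc (by norm_num)
    rwa [zero_add] at this
  have h1 : ∀ x : ℝ, u (x : UnitAddCircle) * conj (lacunaryPoly a s x) =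
      ∑ j ∈ s, conj (a j) * (fourier (-2 ^ j) (x : UnitAddCircle) * u (x : UnitAddCircle)) := by
    intro x
    rw [lacunaryPoly, map_sum, Finset.mul_sum]
    refine Finset.sum_congr rfl fun j _ => ?_
    rw [map_mul, fourier_neg]
    ring
  simp_rw [h1]
  rw [intervalIntegral.integral_finsetSum fun j _ =>
    (hi.continuousOn_mul (continuous_fourier_coe _).continuousOn).const_mul _]
  push_cast
  refine Finset.sum_congr rfl fun j _ => ?_
  have h2 := fourierCoeff_eq_intervalIntegral u (2 ^ j) 0
  rw [ha.1 j] at h2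
  simp only [div_one, one_smul, zero_add, smul_eq_mul] at h2
  rw [intervalIntegral.integral_const_mul, ← h2, Complex.conj_mul']

/-- With `T` the sum on the left, adding the test inequality over the `2^M` arcs tiling `[0, 1]`
gives `2T - T ≤ B`: the pairing of `u` with the block is `T` by its Fourier coefficients. The
constant `κ` may vary with the arc. -/
theorem sum_normSq_le_of_arcs {a : ℕ → ℂ} {u : UnitAddCircle → ℂ}
    (hu : MemLp u 2 (volume : Measure UnitAddCircle)) (ha : IsLacunaryFourierSeries a u)
    {M : ℕ} {B : ℝ} (κ : ℝ → ℂ)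
    (hB : ∀ c : ℝ, ∫ x in c..(c + (2 ^ M)⁻¹), ‖u (x : UnitAddCircle) - κ c‖ ^ 2 ≤ (2 ^ M)⁻¹ * B)
    (J : ℕ) :
    ∑ j ∈ Finset.Ico M J, ‖a j‖ ^ 2 ≤ B := by
  set s := Finset.Ico M J
  have hs : ∀ j ∈ s, M ≤ j := fun j hj => (Finset.mem_Ico.1 hj).1
  set p : ℕ → ℝ := fun k => k * (2 ^ M)⁻¹ with hp
  have hstep : ∀ k, p (k + 1) = p k + (2 ^ M)⁻¹ := fun k => by simp only [hp]; push_cast; ring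
  have hle : ((2 : ℝ) ^ M)⁻¹ ≤ 1 := inv_le_one_of_one_le₀ (one_le_pow₀ (by norm_num))
  have hpos : (0 : ℝ) < (2 ^ M)⁻¹ := by positivity
  have hv : ∀ c : ℝ, MemLp (fun x : ℝ => u (x : UnitAddCircle)) 2
      (volume.restrict (Set.Ioc c (c + (2 ^ M)⁻¹))) := fun c => memLp_comp_coe hu c hle
  have hf := continuous_lacunaryPoly a s
  have h1 : ∀ k, 2 * (∫ x in (p k)..(p (k + 1)), u (x : UnitAddCircle) *
      conj (lacunaryPoly a s x)).re ≤ (2 ^ M)⁻¹ * ∑ j ∈ s, ‖a j‖ ^ 2 + (2 ^ M)⁻¹ * B := by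
    intro k
    have h2 := re_integral_mul_conj_le_oscillation (by linarith) (hv (p k)) hf
      (integral_lacunaryPoly hs (p k)) (κ (p k))
    rw [integral_normSq_lacunaryPoly hs] at h2
    rw [hstep]
    linarith [hB (p k)]
  have h3 := intervalIntegral.sum_integral_adjacent_intervals (a := p) (n := 2 ^ M) (μ := volume)
    (f := fun x : ℝ => u (x : UnitAddCircle) * conj (lacunaryPoly a s x)) fun k _ => by
      rw [hstep]
      exact ((hv _).intervalIntegrable_of_Ioc (by linarith)).mul_continuousOn
        (Complex.continuous_conj.comp hf).continuousOn
  have hp0 : p 0 = 0 := by simp [hp]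
  have hp1 : p (2 ^ M) = 1 := by simp [hp]
  rw [hp0, hp1, integral_mul_conj_lacunaryPoly hu ha] at h3
  have h4 := congrArg Complex.re h3
  rw [Complex.re_sum, Complex.ofReal_re] at h4
  have h5 := Finset.sum_le_sum fun k (_ : k ∈ Finset.range (2 ^ M)) => h1 k
  rw [← Finset.mul_sum, h4, Finset.sum_const, Finset.card_range, nsmul_eq_mul] at h5
  push_cast at h5
  rw [mul_add, mul_inv_cancel_left₀ (by positivity), mul_inv_cancel_left₀ (by positivity)] at h5
  linarith

theorem tailDecay_of_mem_BMO {r : ℝ} (hr : 0 ≤ r) {a : ℕ → ℂ} {u : UnitAddCircle → ℂ}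
    (hu : u ∈ BMO (growthRho (growthPsi r))) (ha : IsLacunaryFourierSeries a u) :
    TailDecay r a := by
  obtain ⟨hL, C, hC⟩ := hu
  refine ⟨((2 * 2 : ℝ) ^ r) ^ 2 * C, fun M J => ?_⟩
  have h2M : (1 : ℝ) ≤ 2 ^ M := one_le_pow₀ (by norm_num)
  set g := growthInv (growthPsi r) (2 ^ M) / 2 ^ M with hg
  have hg1 : 1 ≤ g := one_le_growthInv_div hr h2M
  have hρ : growthRho (growthPsi r) (2 ^ M)⁻¹ = g⁻¹ := by
    rw [growthRho, inv_inv, hg, inv_div]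
  have h1 : ∑ j ∈ Finset.Ico M J, ‖a j‖ ^ 2 ≤ (g ^ 2)⁻¹ * C := by
    refine sum_normSq_le_of_arcs hL ha (fun c => arcAverage u c (2 ^ M)⁻¹) (fun c => ?_) J
    have h2 := hC c (2 ^ M)⁻¹ (by positivity) (inv_le_one_of_one_le₀ h2M)
    rw [hρ, one_div, inv_mul_le_iff₀ (by positivity), inv_pow] at h2
    linarith
  have h3 : ((1 : ℝ) + M) ^ r ≤ (2 * 2 : ℝ) ^ r * g := by
    refine (rpow_one_add_le hr (Nat.cast_nonneg M)
      (one_le_log_add_exp (t := 2 ^ M) (by linarith)) 2 (by norm_num) ?_).trans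
        (by gcongr; exact log_rpow_le_growthInv hr h2M)
    have h4 : M * Real.log 2 ≤ Real.log (2 ^ M + Real.exp 1) := by
      rw [← Real.log_pow]
      exact Real.log_le_log (by positivity) (by linarith [Real.exp_pos 1])
    have := Real.log_two_gt_d9
    have hM : (0 : ℝ) ≤ M := Nat.cast_nonneg M
    nlinarith
  calc (((1 : ℝ) + M) ^ r) ^ 2 * ∑ j ∈ Finset.Ico M J, ‖a j‖ ^ 2
      ≤ ((2 * 2 : ℝ) ^ r * g) ^ 2 * ((g ^ 2)⁻¹ * C) := by
        gcongr
    _ = ((2 * 2 : ℝ) ^ r) ^ 2 * C := by field_simp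

/-! ### Square-summable lacunary series and their holomorphic extensions -/

theorem two_pow_int_injective : Function.Injective fun j : ℕ => (2 ^ j : ℤ) :=
  Int.pow_right_injective (by norm_num)

theorem orthonormal_fourierLp_two_pow :
    Orthonormal ℂ fun j : ℕ => fourierLp (T := 1) 2 (2 ^ j) :=
  orthonormal_fourier.comp _ two_pow_int_injective

theorem Orthonormal.hasSum_normSq {ι E : Type*} [NormedAddCommGroup E] [InnerProductSpace ℂ E]
    {v : ι → E} (hv : Orthonormal ℂ v) {c : ι → ℂ} {x : E} (h : HasSum (fun i => c i • v i) x) :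
    HasSum (fun i => ‖c i‖ ^ 2) (‖x‖ ^ 2) := by
  have h1 := (Filter.Tendsto.norm h).pow 2
  have h2 : ∀ s : Finset ι, ‖∑ i ∈ s, c i • v i‖ ^ 2 = ∑ i ∈ s, ‖c i‖ ^ 2 := fun s => by
    simpa using hv.orthogonalFamily.norm_sum c s
  simp only [h2] at h1
  exact h1

theorem Orthonormal.summable_smul {ι E : Type*} [NormedAddCommGroup E] [InnerProductSpace ℂ E]
    [CompleteSpace E] {v : ι → E} (hv : Orthonormal ℂ v) {c : ι → ℂ}
    (h : Summable fun i => ‖c i‖ ^ 2) : Summable fun i => c i • v i := by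
  simpa using (hv.orthogonalFamily.summable_iff_norm_sq_summable c).2 h

theorem isLacunaryFourierSeries_of_hasSum {a : ℕ → ℂ}
    {U : Lp ℂ 2 (AddCircle.haarAddCircle (T := 1))}
    (hU : HasSum (fun j : ℕ => a j • fourierLp 2 (2 ^ j)) U) :
    IsLacunaryFourierSeries a U := by
  have h1 : ∀ n : ℤ, HasSum (fun j : ℕ => a j * if n = 2 ^ j then 1 else 0) (fourierCoeff U n) := by
    intro n
    rw [← fourierBasis_repr, HilbertBasis.repr_apply_apply, coe_fourierBasis]
    have := (innerSL ℂ (fourierLp (T := 1) 2 n)).hasSum hU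
    simp only [innerSL_apply_apply, inner_smul_right,
      orthonormal_iff_ite.1 orthonormal_fourier] at this
    exact this
  refine ⟨fun j => ?_, fun n hn => ?_⟩
  · refine (h1 (2 ^ j)).unique ?_
    have := hasSum_single (f := fun i : ℕ => a i * if (2 ^ j : ℤ) = 2 ^ i then 1 else 0) j
      fun i hi => by
        rw [if_neg fun h => hi (two_pow_int_injective h).symm, mul_zero]
    simpa using this
  · refine (h1 n).unique ?_
    simp only [hn, if_false, mul_zero]
    exact hasSum_zero

theorem sum_smul_fourierLp_ae_eq (a : ℕ → ℂ) (s : Finset ℕ) :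
    ((∑ j ∈ s, a j • fourierLp 2 (2 ^ j) : Lp ℂ 2 (AddCircle.haarAddCircle (T := 1))) :
      UnitAddCircle → ℂ) =ᵐ[AddCircle.haarAddCircle] fun θ => ∑ j ∈ s, a j * fourier (2 ^ j) θ := by
  have h1 : (∑ j ∈ s, a j • fourierLp 2 (2 ^ j) : Lp ℂ 2 (AddCircle.haarAddCircle (T := 1))) =
      ContinuousMap.toLp (E := ℂ) 2 AddCircle.haarAddCircle ℂ
        (∑ j ∈ s, a j • (fourier (2 ^ j) : C(UnitAddCircle, ℂ))) := by
    rw [map_sum]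
    simp only [map_smul, fourierLp]
  rw [h1]
  refine (ContinuousMap.coeFn_toLp _ _).trans (Eventually.of_forall fun θ => ?_)
  simp [ContinuousMap.sum_apply]

theorem MeasureTheory.Lp.integral_normSq {α : Type*} [MeasurableSpace α] {μ : Measure α}
    (f : Lp ℂ 2 μ) : ∫ t, ‖f t‖ ^ 2 ∂μ = ‖f‖ ^ 2 := by
  have h := L2.inner_def (𝕜 := ℂ) f f
  simp only [inner_self_eq_norm_sq_to_K] at h
  apply Complex.ofReal_injective
  rw [← integral_complex_ofReal]
  push_cast
  exact h.symm

theorem tendsto_integral_normSq_sub_lacunaryPoly {a : ℕ → ℂ}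
    {U : Lp ℂ 2 (AddCircle.haarAddCircle (T := 1))}
    (hU : HasSum (fun j : ℕ => a j • fourierLp 2 (2 ^ j)) U) (c : ℝ) :
    Tendsto (fun J : ℕ => ∫ x in c..(c + 1),
      ‖U (x : UnitAddCircle) - lacunaryPoly a (Finset.range J) x‖ ^ 2) atTop (𝓝 0) := by
  have h1 : ∀ J : ℕ, ∫ x in c..(c + 1),
      ‖U (x : UnitAddCircle) - lacunaryPoly a (Finset.range J) x‖ ^ 2 =
      ‖U - ∑ j ∈ Finset.range J, a j • fourierLp 2 (2 ^ j)‖ ^ 2 := by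
    intro J
    rw [← Lp.integral_normSq]
    have h2 := UnitAddCircle.intervalIntegral_preimage c fun θ : UnitAddCircle =>
      ‖U θ - ∑ j ∈ Finset.range J, a j * fourier (2 ^ j) θ‖ ^ 2
    refine h2.trans ?_
    rw [volume_eq_haarAddCircle]
    refine integral_congr_ae ?_
    filter_upwards [Lp.coeFn_sub U (∑ j ∈ Finset.range J, a j • fourierLp 2 (2 ^ j)),
      sum_smul_fourierLp_ae_eq a (Finset.range J)] with θ h3 h4
    rw [h3, Pi.sub_apply, h4]
  simp_rw [h1]
  have h2 := ((tendsto_const_nhds (x := U)).sub hU.tendsto_sum_nat).norm.pow 2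
  simpa using h2

theorem fourier_two_pow (j : ℕ) (θ : UnitAddCircle) :
    (fourier (2 ^ j) θ : ℂ) = (fourier 1 θ) ^ 2 ^ j := by
  have h : ∀ n : ℕ, (fourier n θ : ℂ) = (fourier 1 θ) ^ n := by
    intro n
    induction n with
    | zero => simp
    | succ n ih => rw [Nat.cast_succ, fourier_add, ih, pow_succ]
  simpa using h (2 ^ j)

/-- The holomorphic function `∑_j a_j z^{2^j}`. -/
noncomputable def lacunaryPowerSeries (a : ℕ → ℂ) (z : ℂ) : ℂ := ∑' j : ℕ, a j * z ^ 2 ^ j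

theorem norm_mul_pow_two_pow_le {a : ℕ → ℂ} {A R : ℝ} (hA : ∀ j, ‖a j‖ ≤ A) (hR1 : R ≤ 1)
    {z : ℂ} (hz : ‖z‖ ≤ R) (j : ℕ) : ‖a j * z ^ 2 ^ j‖ ≤ A * R ^ j := by
  have hR : 0 ≤ R := (norm_nonneg z).trans hz
  rw [norm_mul, norm_pow]
  refine mul_le_mul (hA j) ?_ (by positivity) ((norm_nonneg _).trans (hA j))
  calc ‖z‖ ^ 2 ^ j ≤ R ^ 2 ^ j := by gcongr
    _ ≤ R ^ j := pow_le_pow_of_le_one hR hR1 Nat.lt_two_pow_self.le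

theorem differentiableOn_lacunaryPowerSeries {a : ℕ → ℂ} {A : ℝ} (hA : ∀ j, ‖a j‖ ≤ A) :
    DifferentiableOn ℂ (lacunaryPowerSeries a) (Metric.ball 0 1) := by
  intro z hz
  rw [mem_ball_zero_iff] at hz
  obtain ⟨R, hzR, hR1⟩ := exists_between hz
  have hR : 0 ≤ R := (norm_nonneg z).trans hzR.le
  have h1 : DifferentiableOn ℂ (lacunaryPowerSeries a) (Metric.ball 0 R) :=
    Complex.differentiableOn_tsum_of_summable_norm
      ((summable_geometric_of_lt_one hR hR1).mul_left A)
      (fun j => by fun_prop) Metric.isOpen_ball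
      fun j w hw => norm_mul_pow_two_pow_le hA hR1.le (mem_ball_zero_iff.1 hw).le j
  exact ((h1 z (mem_ball_zero_iff.2 hzR)).differentiableAt
    (Metric.isOpen_ball.mem_nhds (mem_ball_zero_iff.2 hzR))).differentiableWithinAt

theorem norm_le_of_summable_normSq {a : ℕ → ℂ} (h : Summable fun j => ‖a j‖ ^ 2) (j : ℕ) :
    ‖a j‖ ≤ 1 + ∑' j, ‖a j‖ ^ 2 := by
  have := h.le_tsum j fun _ _ => by positivity
  nlinarith [sq_nonneg (‖a j‖ - 1)]

/-- The dilate minus `U` has coefficients `a_j (s^(2^j) - 1)`. Parseval turns its norm into a series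
dominated by `∑ |a_j|²`, with terms tending to zero. -/
theorem isBoundaryValue_lacunaryPowerSeries {a : ℕ → ℂ}
    {U : Lp ℂ 2 (AddCircle.haarAddCircle (T := 1))}
    (hU : HasSum (fun j : ℕ => a j • fourierLp 2 (2 ^ j)) U) :
    IsBoundaryValue (lacunaryPowerSeries a) U := by
  have hsum := (orthonormal_fourierLp_two_pow.hasSum_normSq hU).summable
  have hA := norm_le_of_summable_normSq hsum
  set A := 1 + ∑' j, ‖a j‖ ^ 2
  have hcircle : ∀ θ : UnitAddCircle, ‖(fourier 1 θ : ℂ)‖ = 1 := fun θ => Circle.norm_coe _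
  have key : ∀ s : ℝ, 0 ≤ s → s < 1 →
      eLpNorm (fun θ : UnitAddCircle =>
        lacunaryPowerSeries a ((s : ℂ) * fourier 1 θ) - U θ) 2 volume =
      ENNReal.ofReal √(∑' j, ‖a j * (s : ℂ) ^ 2 ^ j - a j‖ ^ 2) := by
    intro s hs0 hs1
    -- Summing in the sup norm links the pointwise values of the power series with its `L²` class.
    have h1 : Summable fun j : ℕ =>
        (a j * (s : ℂ) ^ 2 ^ j) • (fourier (2 ^ j) : C(UnitAddCircle, ℂ)) := by
      refine Summable.of_norm_bounded ((summable_geometric_of_lt_one hs0 hs1).mul_left A) fun j => ?_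
      rw [norm_smul, fourier_norm, mul_one]
      exact norm_mul_pow_two_pow_le hA hs1.le (by simp [abs_of_nonneg hs0]) j
    obtain ⟨V, hV⟩ := h1
    have h2 : ∀ θ, lacunaryPowerSeries a ((s : ℂ) * fourier 1 θ) = V θ := by
      intro θ
      refine HasSum.tsum_eq ?_
      have := ContinuousMap.hasSum_apply hV θ
      refine this.congr_fun ?_
      intro j
      simp only [ContinuousMap.smul_apply, smul_eq_mul, fourier_two_pow, mul_pow]
      ring
    have h3 := (ContinuousMap.toLp (E := ℂ) 2 (AddCircle.haarAddCircle (T := 1)) ℂ).hasSum hV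
    have h4 : HasSum (fun j : ℕ => (a j * (s : ℂ) ^ 2 ^ j - a j) • fourierLp (T := 1) 2 (2 ^ j))
        (ContinuousMap.toLp (E := ℂ) 2 (AddCircle.haarAddCircle (T := 1)) ℂ V - U) := by
      refine (h3.sub hU).congr_fun ?_
      intro j
      simp only [map_smul, sub_smul]
    have h5 := orthonormal_fourierLp_two_pow.hasSum_normSq h4
    rw [h5.tsum_eq, Real.sqrt_sq (norm_nonneg _), ofReal_norm, Lp.enorm_def,
      volume_eq_haarAddCircle]
    refine eLpNorm_congr_ae ?_
    filter_upwards [Lp.coeFn_sub (ContinuousMap.toLp (E := ℂ) 2 AddCircle.haarAddCircle ℂ V) U,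
      ContinuousMap.coeFn_toLp (p := 2) (𝕜 := ℂ) AddCircle.haarAddCircle V] with θ h6 h7
    rw [h6, Pi.sub_apply, h7, h2]
  have hev : ∀ᶠ s : ℝ in 𝓝[<] 1, 0 ≤ s ∧ s < 1 := by
    filter_upwards [Ioo_mem_nhdsLT (zero_lt_one (α := ℝ))] with s hs using ⟨hs.1.le, hs.2⟩
  have hlim : Tendsto (fun s : ℝ => ∑' j, ‖a j * (s : ℂ) ^ 2 ^ j - a j‖ ^ 2) (𝓝[<] 1)
      (𝓝 (∑' j : ℕ, (0 : ℝ))) := by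
    refine tendsto_tsum_of_dominated_convergence hsum (fun j => ?_) ?_
    · have : Continuous fun s : ℝ => ‖a j * (s : ℂ) ^ 2 ^ j - a j‖ ^ 2 := by fun_prop
      have h := (this.tendsto 1).mono_left (nhdsWithin_le_nhds (s := Set.Iio 1))
      simpa using h
    · filter_upwards [hev] with s hs j
      have h1 : a j * (s : ℂ) ^ 2 ^ j - a j = -(a j * ((1 - s ^ 2 ^ j : ℝ) : ℂ)) := by
        push_cast; ring
      have h2 : s ^ 2 ^ j ≤ 1 := pow_le_one₀ hs.1 hs.2.le
      have h3 : 0 ≤ s ^ 2 ^ j := pow_nonneg hs.1 _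
      rw [h1, norm_neg, norm_mul, Complex.norm_real, Real.norm_of_nonneg (by positivity),
        Real.norm_of_nonneg (by linarith)]
      have : ‖a j‖ * (1 - s ^ 2 ^ j) ≤ ‖a j‖ := mul_le_of_le_one_right (norm_nonneg _) (by linarith)
      have h4 : 0 ≤ 1 - s ^ 2 ^ j := by linarith
      gcongr
  rw [tsum_zero] at hlim
  have h1 := ENNReal.tendsto_ofReal ((Real.continuous_sqrt.tendsto 0).comp hlim)
  rw [Real.sqrt_zero, ENNReal.ofReal_zero] at h1
  refine h1.congr' ?_
  filter_upwards [hev] with s hs using (key s hs.1 hs.2).symm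

/-! ### Sufficiency: oscillation on an arbitrary arc -/

/-- The average minimises the mean square deviation. -/
theorem integral_normSq_sub_average_le {v : ℝ → ℂ} {c ℓ : ℝ} (hℓ : 0 < ℓ)
    (hv : MemLp v 2 (volume.restrict (Set.Ioc c (c + ℓ)))) (κ : ℂ) :
    ∫ x in c..(c + ℓ), ‖v x - (ℓ : ℂ)⁻¹ * ∫ y in c..(c + ℓ), v y‖ ^ 2 ≤
      ∫ x in c..(c + ℓ), ‖v x - κ‖ ^ 2 := by
  set m : ℂ := (ℓ : ℂ)⁻¹ * ∫ y in c..(c + ℓ), v y with hm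
  have hab : c ≤ c + ℓ := by linarith
  have hℓ' : (ℓ : ℂ) ≠ 0 := by exact_mod_cast hℓ.ne'
  have h1 : IntervalIntegrable (fun x => (v x - m) * conj (m - κ)) volume c (c + ℓ) :=
    ((hv.sub (memLp_const m)).intervalIntegrable_of_Ioc hab).mul_const _
  have h2 : ∫ x in c..(c + ℓ), (v x - m) * conj (m - κ) = 0 := by
    rw [intervalIntegral.integral_mul_const,
      intervalIntegral.integral_sub (hv.intervalIntegrable_of_Ioc hab) (by simp),
      intervalIntegral.integral_const, add_sub_cancel_left, hm, Complex.real_smul,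
      mul_inv_cancel_left₀ hℓ', sub_self, zero_mul]
  have h3 : ∫ x in c..(c + ℓ), Complex.reCLM ((v x - m) * conj (m - κ)) = 0 := by
    rw [ContinuousLinearMap.intervalIntegral_comp_comm _ h1, h2, map_zero]
  have h4 : IntervalIntegrable (fun x => Complex.reCLM ((v x - m) * conj (m - κ))) volume
      c (c + ℓ) := by
    rw [intervalIntegrable_iff_integrableOn_Ioc_of_le hab] at h1 ⊢
    exact Complex.reCLM.integrable_comp h1
  have h5 := (hv.sub (memLp_const m)).intervalIntegrable_normSq hab
  have h6 := (hv.sub (memLp_const κ)).intervalIntegrable_normSq hab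
  have h7 := intervalIntegral.integral_mono_on hab (h5.add (h4.const_mul 2)) h6 fun x _ => by
    have h8 := Complex.normSq_add (v x - m) (m - κ)
    rw [sub_add_sub_cancel] at h8
    simp only [Pi.sub_apply, Complex.sq_norm, Complex.reCLM_apply]
    linarith [Complex.normSq_nonneg (m - κ)]
  rw [intervalIntegral.integral_add h5 (h4.const_mul 2), intervalIntegral.integral_const_mul, h3,
    mul_zero, add_zero] at h7
  exact h7

theorem norm_fourier_sub_le (m : ℤ) (x y : ℝ) :
    ‖(fourier m (x : UnitAddCircle) : ℂ) - fourier m (y : UnitAddCircle)‖ ≤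
      2 * Real.pi * |(m : ℝ)| * |x - y| := by
  refine Convex.norm_image_sub_le_of_norm_hasDerivWithin_le
    (f := fun x : ℝ => (fourier m (x : UnitAddCircle) : ℂ))
    (fun z _ => (hasDerivAt_fourier 1 m z).hasDerivWithinAt) (fun z _ => ?_) convex_univ
    (Set.mem_univ y) (Set.mem_univ x)
  have h : ‖(fourier m (z : UnitAddCircle) : ℂ)‖ = 1 := Circle.norm_coe _
  rw [norm_mul, h]
  simp [abs_of_pos Real.pi_pos]

theorem norm_lacunaryPoly_sub_le (a : ℕ → ℂ) (s : Finset ℕ) (x y : ℝ) :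
    ‖lacunaryPoly a s x - lacunaryPoly a s y‖ ≤
      2 * Real.pi * |x - y| * ∑ j ∈ s, ‖a j‖ * 2 ^ j := by
  rw [lacunaryPoly, lacunaryPoly, ← Finset.sum_sub_distrib, Finset.mul_sum]
  refine (norm_sum_le _ _).trans (Finset.sum_le_sum fun j _ => ?_)
  rw [← mul_sub, norm_mul]
  have h := norm_fourier_sub_le (2 ^ j) x y
  push_cast at h
  rw [abs_of_pos (by positivity : (0 : ℝ) < 2 ^ j)] at h
  calc ‖a j‖ * _ ≤ ‖a j‖ * (2 * Real.pi * 2 ^ j * |x - y|) := by gcongr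
    _ = _ := by ring

theorem summable_rpow_mul_half_pow (r : ℝ) :
    Summable fun k : ℕ => ((1 : ℝ) + k) ^ r * (1 / 2) ^ k := by
  set n := ⌈r⌉₊
  have h1 : Summable fun k : ℕ => (k : ℝ) ^ n * (1 / 2 : ℝ) ^ k :=
    summable_pow_mul_geometric_of_norm_lt_one n (by norm_num)
  refine Summable.of_nonneg_of_le (fun k => by positivity) (fun k => ?_)
    (((summable_nat_add_iff 1).2 h1).mul_left 2)
  have h2 : ((1 : ℝ) + k) ^ r ≤ (1 + k) ^ n := by
    rw [← Real.rpow_natCast]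
    exact Real.rpow_le_rpow_of_exponent_le (by linarith [Nat.cast_nonneg (α := ℝ) k])
      (Nat.le_ceil r)
  calc ((1 : ℝ) + k) ^ r * (1 / 2) ^ k ≤ (1 + k) ^ n * (1 / 2) ^ k := by gcongr
    _ = 2 * (((k + 1 : ℕ) : ℝ) ^ n * (1 / 2) ^ (k + 1)) := by push_cast; ring

/-- A tail bounds its first term, so `|a_j| ≤ √K (1 + j)^(-r)`. With `k = M - j`, `1 + M ≤ (1 + j)(1
+ k)` moves the weight from `M` to `j`, at the cost of the convergent series `∑ (1 + k)^r 2⁻ᵏ`. -/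
theorem TailDecay.exists_low_frequency_bound {r : ℝ} (hr : 0 ≤ r) {a : ℕ → ℂ}
    (ha : TailDecay r a) :
    ∃ C : ℝ, ∀ M : ℕ, ((1 : ℝ) + M) ^ r *
      ((2 ^ M)⁻¹ * ∑ j ∈ Finset.range M, ‖a j‖ * 2 ^ j) ≤ C := by
  obtain ⟨K, hK⟩ := ha
  have hsum := summable_rpow_mul_half_pow r
  refine ⟨√K * ∑' k : ℕ, ((1 : ℝ) + k) ^ r * (1 / 2) ^ k, fun M => ?_⟩
  have h1 : ∀ j, ((1 : ℝ) + j) ^ r * ‖a j‖ ≤ √K := by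
    intro j
    have h := hK j (j + 1)
    rw [Nat.Ico_succ_singleton, Finset.sum_singleton, ← mul_pow] at h
    exact Real.le_sqrt_of_sq_le h
  have h2 : ∀ j ∈ Finset.range M, ((1 : ℝ) + M) ^ r * ((2 ^ M)⁻¹ * (‖a j‖ * 2 ^ j)) ≤
      √K * (((1 : ℝ) + (M - j : ℕ)) ^ r * (1 / 2) ^ (M - j)) := by
    intro j hj
    have hjM : j ≤ M := (Finset.mem_range.1 hj).le
    obtain ⟨k, rfl⟩ := Nat.exists_eq_add_of_le hjM
    rw [Nat.add_sub_cancel_left]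
    have h3 : ((1 : ℝ) + (j + k : ℕ)) ^ r ≤ (1 + j) ^ r * (1 + k) ^ r := by
      rw [← Real.mul_rpow (by positivity) (by positivity)]
      refine Real.rpow_le_rpow (by positivity) ?_ hr
      push_cast
      nlinarith [mul_nonneg (Nat.cast_nonneg (α := ℝ) j) (Nat.cast_nonneg (α := ℝ) k)]
    calc ((1 : ℝ) + (j + k : ℕ)) ^ r * ((2 ^ (j + k))⁻¹ * (‖a j‖ * 2 ^ j))
        ≤ ((1 + j) ^ r * (1 + k) ^ r) * ((2 ^ (j + k))⁻¹ * (‖a j‖ * 2 ^ j)) := by gcongr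
      _ = ((1 + j) ^ r * ‖a j‖) * ((1 + k) ^ r * (1 / 2) ^ k) := by
          rw [pow_add, one_div, inv_pow]; field_simp
      _ ≤ _ := by gcongr; exact h1 j
  rw [Finset.mul_sum, Finset.mul_sum]
  refine (Finset.sum_le_sum h2).trans ?_
  rw [← Finset.mul_sum]
  refine mul_le_mul_of_nonneg_left ?_ (Real.sqrt_nonneg K)
  calc ∑ j ∈ Finset.range M, ((1 : ℝ) + (M - j : ℕ)) ^ r * (1 / 2) ^ (M - j)
      -- The extra term `j = M` makes `j ↦ M - j` a reflection of the index range.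
      ≤ ∑ j ∈ Finset.range (M + 1), ((1 : ℝ) + (M - j : ℕ)) ^ r * (1 / 2) ^ (M - j) :=
        Finset.sum_le_sum_of_subset_of_nonneg (Finset.range_mono (Nat.le_succ M))
          fun _ _ _ => by positivity
    _ = ∑ k ∈ Finset.range (M + 1), ((1 : ℝ) + k) ^ r * (1 / 2) ^ k := by
        have h := Finset.sum_range_reflect
          (fun k : ℕ => ((1 : ℝ) + k) ^ r * (1 / 2 : ℝ) ^ k) (M + 1)
        simp only [Nat.add_sub_cancel] at h
        exact h
    _ ≤ _ := hsum.sum_le_tsum _ fun _ _ => by positivity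

theorem normSq_add_add_le (x y z : ℂ) :
    ‖x + y + z‖ ^ 2 ≤ 3 * (‖x‖ ^ 2 + ‖y‖ ^ 2 + ‖z‖ ^ 2) := by
  have h : ‖x + y + z‖ ≤ ‖x‖ + ‖y‖ + ‖z‖ := norm_add₃_le
  have h1 : ‖x + y + z‖ ^ 2 ≤ (‖x‖ + ‖y‖ + ‖z‖) ^ 2 := by gcongr
  nlinarith [sq_nonneg (‖x‖ - ‖y‖), sq_nonneg (‖y‖ - ‖z‖), sq_nonneg (‖x‖ - ‖z‖)]

/-- Splits `u - P(c)` into the variation of the low frequencies `P`, the block up to `J`, and a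
remainder. The block is integrated over the longer arc of length `2⁻ᴹ`, where it is orthogonal, and
the remainder over a full period, where it vanishes as `J → ∞`. -/
theorem integral_normSq_sub_le {a : ℕ → ℂ} {u : UnitAddCircle → ℂ}
    (hu : MemLp u 2 (volume : Measure UnitAddCircle)) {c ℓ : ℝ} (hℓ : 0 < ℓ) {M : ℕ}
    (hM : ℓ ≤ (2 ^ M)⁻¹) {J : ℕ} (hJ : M ≤ J) :
    ∫ x in c..(c + ℓ), ‖u (x : UnitAddCircle) - lacunaryPoly a (Finset.range M) c‖ ^ 2 ≤
      3 * (ℓ * (2 * Real.pi * ((2 ^ M)⁻¹ * ∑ j ∈ Finset.range M, ‖a j‖ * 2 ^ j)) ^ 2 +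
        (2 ^ M)⁻¹ * ∑ j ∈ Finset.Ico M J, ‖a j‖ ^ 2 +
        ∫ x in c..(c + 1), ‖u (x : UnitAddCircle) - lacunaryPoly a (Finset.range J) x‖ ^ 2) := by
  set P := lacunaryPoly a (Finset.range M)
  set h := lacunaryPoly a (Finset.Ico M J) with hh
  set S := lacunaryPoly a (Finset.range J)
  set E := 2 * Real.pi * ((2 ^ M)⁻¹ * ∑ j ∈ Finset.range M, ‖a j‖ * 2 ^ j) with hE
  have hPS : ∀ x, S x = P x + h x := fun x => (Finset.sum_range_add_sum_Ico _ hJ).symm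
  have hab : c ≤ c + ℓ := by linarith
  have hM1 : ((2 : ℝ) ^ M)⁻¹ ≤ 1 := inv_le_one_of_one_le₀ (one_le_pow₀ (by norm_num))
  have hv := memLp_comp_coe hu c (hM.trans hM1)
  have hv1 := memLp_comp_coe hu c le_rfl
  have hS : Continuous S := continuous_lacunaryPoly a _
  have hSc : MemLp S 2 (volume.restrict (Set.Ioc c (c + 1))) :=
    (memLp_two_iff_integrable_sq_norm hS.aestronglyMeasurable).2 (hS.norm.pow 2).integrableOn_Ioc
  have hhc : Continuous h := continuous_lacunaryPoly a _
  have i1 : IntervalIntegrable (fun x => ‖h x‖ ^ 2) volume c (c + ℓ) :=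
    (hhc.norm.pow 2).intervalIntegrable _ _
  have i1' : IntervalIntegrable (fun x => ‖h x‖ ^ 2) volume c (c + (2 ^ M)⁻¹) :=
    (hhc.norm.pow 2).intervalIntegrable _ _
  have i2' : IntervalIntegrable (fun x : ℝ => ‖u (x : UnitAddCircle) - S x‖ ^ 2) volume
      c (c + 1) := (hv1.sub hSc).intervalIntegrable_normSq (by linarith)
  have i2 : IntervalIntegrable (fun x : ℝ => ‖u (x : UnitAddCircle) - S x‖ ^ 2) volume
      c (c + ℓ) := by
    refine i2'.mono_set ?_
    rw [Set.uIcc_of_le hab, Set.uIcc_of_le (by linarith)]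
    exact Set.Icc_subset_Icc_right (by linarith)
  have i3 : IntervalIntegrable (fun x : ℝ => ‖u (x : UnitAddCircle) - P c‖ ^ 2) volume
      c (c + ℓ) := (hv.sub (memLp_const (P c))).intervalIntegrable_normSq hab
  have h1 : ∫ x in c..(c + ℓ), ‖h x‖ ^ 2 ≤ (2 ^ M)⁻¹ * ∑ j ∈ Finset.Ico M J, ‖a j‖ ^ 2 := by
    rw [← integral_normSq_lacunaryPoly (fun j hj => (Finset.mem_Ico.1 hj).1) c, ← hh]
    exact intervalIntegral.integral_mono_interval le_rfl hab (by linarith)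
      (Eventually.of_forall fun _ => sq_nonneg _) i1'
  have h2 : ∫ x in c..(c + ℓ), ‖u (x : UnitAddCircle) - S x‖ ^ 2 ≤
      ∫ x in c..(c + 1), ‖u (x : UnitAddCircle) - S x‖ ^ 2 :=
    intervalIntegral.integral_mono_interval le_rfl hab (by linarith)
      (Eventually.of_forall fun _ => sq_nonneg _) i2'
  have h3 := intervalIntegral.integral_mono_on hab i3
    ((((intervalIntegrable_const (c := E ^ 2)).add i1).add i2).const_mul 3) fun x hx => by
      have h4 : ‖P x - P c‖ ≤ E := by
        refine (norm_lacunaryPoly_sub_le a _ x c).trans ?_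
        rw [hE, abs_of_nonneg (by linarith [hx.1]), mul_assoc (2 * Real.pi)]
        have : x - c ≤ (2 ^ M)⁻¹ := by linarith [hx.2]
        gcongr
      have h5 := normSq_add_add_le (P x - P c) (h x) (u (x : UnitAddCircle) - S x)
      have h6 : P x - P c + h x + (u (x : UnitAddCircle) - S x) =
          u (x : UnitAddCircle) - P c := by rw [hPS]; ring
      rw [h6] at h5
      have h7 : ‖P x - P c‖ ^ 2 ≤ E ^ 2 := by gcongr
      linarith
  rw [intervalIntegral.integral_const_mul, intervalIntegral.integral_add
    (intervalIntegrable_const.add i1) i2, intervalIntegral.integral_add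
    intervalIntegrable_const i1, intervalIntegral.integral_const, add_sub_cancel_left,
    smul_eq_mul] at h3
  linarith

theorem exists_mem_BMOA_of_tailDecay {r : ℝ} (hr : 0 ≤ r) {a : ℕ → ℂ} (ha : TailDecay r a) :
    ∃ u ∈ BMOA (growthRho (growthPsi r)), IsLacunaryFourierSeries a u := by
  obtain ⟨C, hC⟩ := ha.exists_low_frequency_bound hr
  obtain ⟨K, hK⟩ := ha
  obtain ⟨D, hD, hG⟩ := growthInv_le r hr
  have hsum : Summable fun j => ‖a j‖ ^ 2 :=
    summable_of_sum_range_le (c := K) (fun _ => by positivity) fun J => by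
      simpa using hK 0 J
  obtain ⟨U, hU⟩ := orthonormal_fourierLp_two_pow.summable_smul hsum
  have hUL : MemLp U 2 (volume : Measure UnitAddCircle) := by
    rw [volume_eq_haarAddCircle]
    exact Lp.memLp U
  refine ⟨U, ⟨⟨hUL, (D * 2 ^ r) ^ 2 * (3 * ((2 * Real.pi * C) ^ 2 + 2 * K)), ?_⟩,
    lacunaryPowerSeries a,
    differentiableOn_lacunaryPowerSeries (norm_le_of_summable_normSq hsum),
    isBoundaryValue_lacunaryPowerSeries hU⟩, isLacunaryFourierSeries_of_hasSum hU⟩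
  intro c ℓ hℓ hℓ1
  have hinv : 1 ≤ ℓ⁻¹ := (one_le_inv₀ hℓ).2 hℓ1
  -- The dyadic scale of the arc: `2^M ≤ 1/ℓ < 2^(M+1)`.
  obtain ⟨M, hM1, hM2⟩ := exists_nat_pow_near hinv (one_lt_two)
  have hM3 : ℓ ≤ (2 ^ M)⁻¹ := by
    rw [le_inv_comm₀ hℓ (by positivity)]; exact hM1
  have hM4 : ((2 : ℝ) ^ M)⁻¹ ≤ 2 * ℓ := by
    rw [inv_le_iff_one_le_mul₀ (by positivity)]
    have := (inv_lt_iff_one_lt_mul₀ hℓ).1 hM2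
    rw [pow_succ] at this
    linarith
  set W := ((1 : ℝ) + M) ^ r with hW
  have hWpos : 0 < W := by positivity
  set I := ∫ θ in c..(c + ℓ), ‖U (θ : UnitAddCircle) - arcAverage U c ℓ‖ ^ 2
  have hI : ∀ J, M ≤ J → W ^ 2 * I ≤ 3 * ((2 * Real.pi * C) ^ 2 + 2 * K) * ℓ + 3 * W ^ 2 *
      ∫ x in c..(c + 1), ‖U (x : UnitAddCircle) - lacunaryPoly a (Finset.range J) x‖ ^ 2 := by
    intro J hJ
    have h1 := (integral_normSq_sub_average_le hℓ (memLp_comp_coe hUL c hℓ1)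
      (lacunaryPoly a (Finset.range M) c)).trans (integral_normSq_sub_le hUL hℓ hM3 hJ)
    have h2 := mul_le_mul_of_nonneg_left h1 (sq_nonneg W)
    set R := ∫ x in c..(c + 1), ‖U (x : UnitAddCircle) - lacunaryPoly a (Finset.range J) x‖ ^ 2
    set X := (2 ^ M)⁻¹ * ∑ j ∈ Finset.range M, ‖a j‖ * 2 ^ j
    set T := ∑ j ∈ Finset.Ico M J, ‖a j‖ ^ 2 with hT
    have hX : 0 ≤ X := by positivity
    have hT0 : 0 ≤ T := by positivity
    have h3 : (2 * Real.pi * (W * X)) ^ 2 ≤ (2 * Real.pi * C) ^ 2 := by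
      have := hC M
      gcongr
    have h4 : W ^ 2 * ((2 ^ M)⁻¹ * T) ≤ 2 * ℓ * K := by
      calc W ^ 2 * ((2 ^ M)⁻¹ * T) = (2 ^ M)⁻¹ * (W ^ 2 * T) := by ring
        _ ≤ 2 * ℓ * (W ^ 2 * T) := by gcongr
        _ ≤ 2 * ℓ * K := by gcongr; exact hK M J
    have h5 := mul_le_mul_of_nonneg_left h3 hℓ.le
    calc W ^ 2 * I ≤ _ := h2
      _ = 3 * (ℓ * (2 * Real.pi * (W * X)) ^ 2 + W ^ 2 * ((2 ^ M)⁻¹ * T)) + 3 * W ^ 2 * R := by ring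
      _ ≤ _ := by linarith
  have hlim : W ^ 2 * I ≤ 3 * ((2 * Real.pi * C) ^ 2 + 2 * K) * ℓ := by
    have h1 := ((tendsto_integral_normSq_sub_lacunaryPoly hU c).const_mul (3 * W ^ 2)).const_add
      (3 * ((2 * Real.pi * C) ^ 2 + 2 * K) * ℓ)
    rw [mul_zero, add_zero] at h1
    exact ge_of_tendsto h1 ((eventually_ge_atTop M).mono hI)
  set g := growthInv (growthPsi r) ℓ⁻¹ / ℓ⁻¹ with hg
  have hg1 : 1 ≤ g := one_le_growthInv_div hr hinv
  have hρ : growthRho (growthPsi r) ℓ = g⁻¹ := by rw [growthRho, hg, inv_div]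
  have hgW : g ≤ D * 2 ^ r * W := by
    refine (hG _ hinv).trans ?_
    rw [mul_assoc, hW, ← Real.mul_rpow (by norm_num) (by positivity)]
    have hl := Real.log_nonneg hinv
    have h1 : Real.log ℓ⁻¹ ≤ M + 1 := by
      have h2 := Real.log_le_log (by positivity) hM2.le
      rw [Real.log_pow] at h2
      push_cast at h2
      have := Real.log_two_lt_d9
      have hM0 : (0 : ℝ) ≤ M := Nat.cast_nonneg M
      nlinarith
    have hM0 : (0 : ℝ) ≤ M := Nat.cast_nonneg M
    gcongr
    linarith
  have hI0 : 0 ≤ I := intervalIntegral.integral_nonneg (by linarith) fun _ _ => sq_nonneg _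
  rw [hρ]
  calc 1 / (g⁻¹ ^ 2 * ℓ) * I = g ^ 2 * I / ℓ := by
        have : g ≠ 0 := by positivity
        field_simp
    _ ≤ (D * 2 ^ r * W) ^ 2 * I / ℓ := by gcongr
    _ = (D * 2 ^ r) ^ 2 * (W ^ 2 * I) / ℓ := by ring
    _ ≤ (D * 2 ^ r) ^ 2 * (3 * ((2 * Real.pi * C) ^ 2 + 2 * K) * ℓ) / ℓ := by gcongr
    _ = _ := by field_simp

theorem exists_mem_BMOA_iff_tailDecay {r : ℝ} (hr : 0 ≤ r) (a : ℕ → ℂ) :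
    (∃ u ∈ BMOA (growthRho (growthPsi r)), IsLacunaryFourierSeries a u) ↔ TailDecay r a :=
  ⟨fun ⟨_, hu, ha⟩ => tailDecay_of_mem_BMO hr hu.1 ha, exists_mem_BMOA_of_tailDecay hr⟩

theorem mainTheorem7 :
    (∀ r : ℝ, 0 ≤ r → ∀ a : ℕ → ℂ,
      (∃ u ∈ BMOA (growthRho (growthPsi r)), IsLacunaryFourierSeries a u) ↔
        (⨆ (N : ℕ) (_ : 1 ≤ N),
          ENNReal.ofReal ((growthInv (growthPsi r) N / N) ^ 2) * logTail a N) < ⊤) ∧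
    (∀ a : ℕ → ℂ,
      (∃ u ∈ LMOA, IsLacunaryFourierSeries a u) ↔
        (⨆ (N : ℕ) (_ : 1 ≤ N),
          ENNReal.ofReal (Real.log N ^ 2) * logTail a N) < ⊤) :=
  ⟨fun _ hr a => (exists_mem_BMOA_iff_tailDecay hr a).trans (tailDecay_iff_growthInv hr a).symm,
    fun a => (exists_mem_BMOA_iff_tailDecay zero_le_one a).trans (tailDecay_one_iff_log a).symm⟩
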